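/- Let $F_r$ be the free group with basis $x_1,\dots,x_r$. An element $u\in F_r$ is called primitive if some automorphism of $F_r$ takes $x_1$ to $u$. A (reduced) word $v$ is called primitivity-blocking in $F_r$ if, for every $\varphi\in\mathrm{Aut}(F_r)$, $v$ is not a (contiguous) subword of the cyclic reduction of $\varphi(x_1)$. (a) In $F_2$, the word $x_1^kx_2^k$ is primitivity-blocking for every integer $k\ge2$. (b) In $F_r$ with $r\ge3$, the word $x_1^kx_2^k\cdots x_r^k$ is not primitivity-blocking for any integer $k\ge1$. Explicitly, the element $$x_1^k x_2^k\cdots x_r^k\,x_{r-1}^{-k}x_{r-2}^{-k}\cdots x_1^{-k}\,x_2$$ is primitive, its reduced word is cyclically reduced, and this word contains $x_1^k\cdots x_r^k$ as a subword. -/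

import Mathlib

/-! `FreeGroup (Fin r)` is the free group `F_r`; its basis element `x_{i+1}` is `FreeGroup.of i`.
A (reduced) word is identified with the element it represents, and `u.toWord` is the reduced word
of `u` as a list of letters; "subword" means contiguous sublist (`<:+:`). -/

/-- `u` is primitive if some automorphism of `F_r` takes `x_1` to `u`. -/
def IsPrimitive {r : ℕ} [NeZero r] (u : FreeGroup (Fin r)) : Prop :=
  ∃ φ : MulAut (FreeGroup (Fin r)), φ (FreeGroup.of 0) = u

/-- `v` is `w`-orbit-blocking if for every automorphism `φ` of `F_r`, the word `v` is not a subword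
of the cyclic reduction of `φ w`. -/
def IsOrbitBlocking {r : ℕ} (w v : FreeGroup (Fin r)) : Prop :=
  ∀ φ : MulAut (FreeGroup (Fin r)),
    ¬ v.toWord <:+: FreeGroup.reduceCyclically (φ w).toWord

/-- Primitivity-blocking means `x_1`-orbit-blocking. -/
def IsPrimitivityBlocking {r : ℕ} [NeZero r] (v : FreeGroup (Fin r)) : Prop :=
  IsOrbitBlocking (FreeGroup.of 0) v

/-- The element `x_1 ^ k * x_2 ^ k * ⋯ * x_m ^ k` of `F_r`, for `m ≤ r`. -/
def powersProd {r : ℕ} (m : ℕ) (hm : m ≤ r) (k : ℕ) : FreeGroup (Fin r) :=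
  (List.ofFn fun i : Fin m => FreeGroup.of (Fin.castLE hm i) ^ k).prod

/-- The element `x_1 ^ k ⋯ x_r ^ k * x_{r-1} ^ (-k) ⋯ x_1 ^ (-k) * x_2` of `F_r`. -/
def witnessWord (r : ℕ) (hr : 3 ≤ r) (k : ℕ) : FreeGroup (Fin r) :=
  powersProd r le_rfl k * (powersProd (r - 1) (Nat.sub_le r 1) k)⁻¹ * FreeGroup.of ⟨1, by omega⟩

/-! A word that contains `x ^ 2 y ^ 2` is kept out of the cyclic reduction of a primitive element of
`F_2` by Whitehead's cut vertex lemma (`exists_cut_vertex`): the Whitehead graph of a cyclically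
reduced conjugate of a primitive element becomes disconnected when a suitable vertex, or none, is
removed. The subword `x x y y` gives the Whitehead graph a path through all four letters
`x, x⁻¹, y, y⁻¹`. Both generators occur, so the cyclic word has an `x` that does not follow `x` and
a `y` that does not precede `y`, and the two edges that these contribute exclude a cut vertex
(`not_isConj_of_infix`).

The cut vertex lemma is proved with almost invariant colourings of the Cayley tree, without normal
forms for automorphisms. Let `u = φ x_a` and let `b ≠ a`. Colour a group element by whether its
normal form in the basis `φ x_i` starts with `φ x_b`. Right multiplication by `u` preserves the
colour, both colours occur infinitely often, and only finitely many edges of the Cayley tree in the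
original basis join different colours (`exists_almostInvariant`). So the ends of the tree are
coloured, and both ends of each translate of the axis of `u` have the same colour. Take a vertex `L`
at maximal distance from the root such that the ends beyond `L` do not all have one colour
(`AlmostInvariant.exists_maximal_cone`). In each direction at `L` other than the one towards the
root, all ends have one colour. The translates of axes that pass through `L` are the edges of the
Whitehead graph, and they join directions of equal colour (`AlmostInvariant.colour_eq_of_ray`).
Hence the direction towards the root is a cut vertex.

For `r ≥ 3`, put `P = x_1 ^ k ⋯ x_{r-1} ^ k`. Then `P x_r ^ k P⁻¹ x_2` is the image of `x_r ^ k x_2`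
under the automorphism that conjugates `x_r` by `P`, since `x_2 ≠ x_r`, and `x_r ^ k x_2` is
primitive (`isPrimitive_witnessWord`). No cancellation occurs at the junctions of the factors. -/

namespace FreeGroup

section CutVertex

variable {α : Type*}

/-! ### Cyclically reduced words and their rotations -/

theorem isCyclicallyReduced_iff_isReduced_append_self {W : List (α × Bool)} :
    IsCyclicallyReduced W ↔ IsReduced (W ++ W) := by
  rw [IsCyclicallyReduced, IsReduced, IsReduced, List.isChain_append]
  tauto

theorem IsCyclicallyReduced.append_comm {l₁ l₂ : List (α × Bool)}
    (h : IsCyclicallyReduced (l₁ ++ l₂)) : IsCyclicallyReduced (l₂ ++ l₁) := by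
  rw [isCyclicallyReduced_iff_isReduced_append_self]
  exact (h.flatten_replicate 3).isReduced.infix ⟨l₁, l₂, by simp [List.replicate_succ]⟩

theorem IsCyclicallyReduced.invRev {W : List (α × Bool)} (h : IsCyclicallyReduced W) :
    IsCyclicallyReduced (invRev W) := by
  classical
  rw [isCyclicallyReduced_iff_isReduced_append_self, isReduced_iff_reduce_eq] at h ⊢
  rw [← invRev_append, reduce_invRev, h]

theorem IsCyclicallyReduced.reduceCyclically_eq [DecidableEq α] {W : List (α × Bool)}
    (h : IsCyclicallyReduced W) : reduceCyclically W = W := by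
  induction W using List.bidirectionalRec
  case nil => simp
  case singleton => simp
  case cons_append a l b _ =>
    rw [reduceCyclically.cons_append, if_neg, List.cons_append]
    rintro ⟨h1, h2⟩
    have := (isCyclicallyReduced_cons_append_iff.1 h).2 h1
    simp [← h2] at this

/-- Cyclic permutations of a word represent conjugate elements. -/
theorem isConj_mk_append_comm (l₁ l₂ : List (α × Bool)) :
    IsConj (mk (l₁ ++ l₂)) (mk (l₂ ++ l₁)) :=
  isConj_iff.2 ⟨(mk l₁)⁻¹, by simp only [← mul_mk]; group⟩

theorem isConj_mk_reduceCyclically [DecidableEq α] (g : FreeGroup α) :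
    IsConj (mk (reduceCyclically g.toWord)) g :=
  isConj_iff.2 ⟨mk (reduceCyclically.conjugator g.toWord), by
    rw [inv_mk, mul_mk, mul_mk, reduceCyclically.conj_conjugator_reduceCyclically, mk_toWord]⟩

/-! ### Almost invariant colourings -/

/-- A two-colouring of a group is almost invariant if each right translation changes the colour of
only finitely many elements. In a free group, this says that only finitely many edges of the Cayley
tree join vertices of different colours, so that the colouring extends to the ends of the tree. -/
def AlmostInvariant {G : Type*} [Group G] (c : G → Bool) : Prop :=
  ∀ z, {g | c (g * z) ≠ c g}.Finite

/-- All but finitely many of the reduced words with prefix `L` have colour `ε`. These words are the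
vertices of the Cayley tree that are separated from the root by the vertex `L`. If `L` is not
reduced, there are none, and the condition holds for both colours. -/
def AlmostConstOnCone [DecidableEq α] (c : FreeGroup α → Bool) (L : List (α × Bool)) (ε : Bool) :
    Prop :=
  {h : FreeGroup α | L <+: h.toWord ∧ c h ≠ ε}.Finite

variable [DecidableEq α] {c : FreeGroup α → Bool}

theorem almostConstOnCone_of_not_isReduced {L : List (α × Bool)} (hL : ¬ IsReduced L) (ε : Bool) :
    AlmostConstOnCone c L ε := by
  exact Set.finite_empty.subset fun h hh => hL (isReduced_toWord.infix hh.1.isInfix)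

/-- Beyond all the colour changes, every cone has a single colour. -/
theorem AlmostInvariant.exists_forall_cone [Finite α] (hc : AlmostInvariant c) :
    ∃ N, ∀ L : List (α × Bool), N ≤ L.length → ∃ ε, AlmostConstOnCone c L ε := by
  have hfin : (⋃ s : α × Bool, {g | c (g * mk [s]) ≠ c g}).Finite :=
    Set.finite_iUnion fun s => hc _
  obtain ⟨N, hN⟩ := (hfin.image norm).bddAbove
  refine ⟨N + 1, fun L hL => ⟨c (mk L), ?_⟩⟩
  refine Set.finite_empty.subset ?_
  rintro h ⟨⟨t, ht⟩, hne⟩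
  apply hne
  have key : ∀ t : List (α × Bool), IsReduced (L ++ t) → c (mk (L ++ t)) = c (mk L) := by
    intro t
    induction t using List.reverseRecOn with
    | nil => simp
    | append_singleton t s ih =>
      intro hred
      have hred' : IsReduced (L ++ t) := hred.infix ⟨[], [s], by simp⟩
      rw [← ih hred', ← List.append_assoc, ← mul_mk]
      by_contra hne
      have h1 : norm (mk (L ++ t)) ≤ N :=
        hN ⟨_, Set.mem_iUnion.2 ⟨s, hne⟩, rfl⟩
      rw [norm, toWord_mk, hred'.reduce_eq, List.length_append] at h1
      omega
  rw [← key t (ht ▸ isReduced_toWord), ht, mk_toWord]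

/-- If both colours occur infinitely often, there is a deepest vertex `L` whose cone is not almost
of one colour. -/
theorem AlmostInvariant.exists_maximal_cone [Finite α] (hc : AlmostInvariant c)
    (h0 : ¬ ∃ ε, AlmostConstOnCone c [] ε) :
    ∃ L, (¬ ∃ ε, AlmostConstOnCone c L ε) ∧ ∀ s, ∃ ε, AlmostConstOnCone c (L ++ [s]) ε := by
  by_contra! hcon
  obtain ⟨N, hN⟩ := hc.exists_forall_cone
  have : ∀ n, ∃ L : List (α × Bool), L.length = n ∧ ∀ ε, ¬ AlmostConstOnCone c L ε := by
    intro n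
    induction n with
    | zero => exact ⟨[], rfl, by simpa using h0⟩
    | succ n ih =>
      obtain ⟨L, hL, hL'⟩ := ih
      obtain ⟨s, hs⟩ := hcon L hL'
      exact ⟨L ++ [s], by simp [hL], hs⟩
  obtain ⟨L, hL, hL'⟩ := this N
  obtain ⟨ε, hε⟩ := hN L hL.ge
  exact hL' ε hε

/-- If all cones that hang from the vertex `L` are almost of one colour, the same for all of them,
then so is the cone of `L`. -/
theorem almostConstOnCone_of_forall [Finite α] {L : List (α × Bool)} {ε : Bool}
    (h : ∀ s, AlmostConstOnCone c (L ++ [s]) ε) : AlmostConstOnCone c L ε := by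
  refine ((Set.finite_singleton (mk L)).union (Set.finite_iUnion h)).subset ?_
  rintro g ⟨⟨t, ht⟩, hg⟩
  rcases t with - | ⟨s, t⟩
  · left
    rw [Set.mem_singleton_iff, ← mk_toWord (x := g), ← ht, List.append_nil]
  · right
    exact Set.mem_iUnion.2 ⟨s, ⟨t, by simp [← ht]⟩, hg⟩

/-- A periodic ray `L W W W ⋯` determines the colour of the cone into which it leaves `L`: when the
colouring is invariant under a conjugate `z W z⁻¹`, that colour is `c (L z⁻¹)`. -/
theorem AlmostInvariant.colour_eq_of_ray (hc : AlmostInvariant c) {L W : List (α × Bool)}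
    {s : α × Bool} {z : FreeGroup α} {ε : Bool}
    (hz : ∀ h, c (h * (z * mk W * z⁻¹)) = c h) (hW : IsCyclicallyReduced W)
    (hs : s ∈ W.head?) (hL : IsReduced (L ++ [s])) (hε : AlmostConstOnCone c (L ++ [s]) ε) :
    c (mk L * z⁻¹) = ε := by
  obtain ⟨W', rfl⟩ : ∃ W', W = s :: W' := by
    cases W with
    | nil => simp at hs
    | cons a l => simp at hs; exact ⟨l, by rw [hs]⟩
  have hLW : IsReduced (L ++ (s :: W') ++ []) := by
    simpa using hL.append_overlap (L₃ := W') (by simpa using hW.isReduced) (by simp)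
  have hword (n : ℕ) : (mk L * mk (s :: W') ^ (n + 1)).toWord =
      L ++ (List.replicate (n + 1) (s :: W')).flatten := by
    rw [pow_mk, mul_mk, toWord_mk]
    apply IsReduced.reduce_eq
    simpa using IsReduced.append_flatten_replicate_append hW hLW n.succ_ne_zero
  have hinj : Function.Injective fun n : ℕ => mk L * mk (s :: W') ^ (n + 1) := by
    intro m n hmn
    have := congrArg (fun g => g.toWord.length) hmn
    simp only [hword] at this
    simpa using this
  obtain ⟨n, hn⟩ :=
    (((hε.union (hc z⁻¹)).preimage hinj.injOn).infinite_compl).nonempty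
  simp only [Set.mem_compl_iff, Set.mem_preimage, Set.mem_union, Set.mem_ofPred_eq, not_or, not_and,
    not_not] at hn
  have hpow : ∀ (m : ℕ) h, c (h * (z * mk (s :: W') * z⁻¹) ^ m) = c h := by
    intro m
    induction m with
    | zero => simp
    | succ m ih => intro h; rw [pow_succ, ← mul_assoc, hz, ih]
  rw [← hn.1 (by rw [hword]; exact ⟨W' ++ (List.replicate n (s :: W')).flatten,
    by simp [List.replicate_succ]⟩), ← hn.2, ← hpow (n + 1), conj_pow]
  congr 1
  group

/-! ### Whitehead's cut vertex lemma -/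

/-- Colour `g` by whether its normal form in the basis `φ x_i` starts with the basis element
`φ x_b`. The colouring is almost invariant, takes both values infinitely often, and is invariant
under right multiplication by the basis elements other than `φ x_b`. -/
theorem exists_almostInvariant (φ : MulAut (FreeGroup α)) {a b : α} (hab : a ≠ b) :
    ∃ c : FreeGroup α → Bool, AlmostInvariant c ∧ (∀ h, c (h * φ (of a)) = c h) ∧
      c 1 ≠ c (φ (of b)) := by
  -- The first letter of `g` is read off as the inverse of the last letter of `g⁻¹`, because
  -- `reduce` works from the left.
  let d : FreeGroup α → Bool := fun k => decide (k.toWord.getLast? = some (b, false))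
  have hd (s : α × Bool) (k : FreeGroup α) (hne : d (mk [s] * k) ≠ d k) :
      s.1 = b ∧ (k = 1 ∨ k = mk [(b, false)]) := by
    have hk : (mk [s] * k).toWord = reduce (s :: k.toWord) := by
      rw [toWord_mul, toWord_mk, reduce_singleton]; rfl
    have hk2 : k = mk k.toWord := mk_toWord.symm
    simp only [d, hk, reduce.cons, reduce_toWord] at hne
    generalize k.toWord = w at hne hk2
    subst hk2
    rcases w with - | ⟨t, - | ⟨t', w⟩⟩
    · simp at hne
      simp [hne, one_eq_mk]
    · simp only at hne
      split_ifs at hne with h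
      · simp at hne
        subst hne
        exact ⟨h.1, Or.inr rfl⟩
      · simp at hne
    · simp only at hne
      split_ifs at hne with h <;> simp at hne
  have hd' : ∀ z : FreeGroup α, {k | d (z * k) ≠ d k}.Finite := by
    have hs (s : α × Bool) : {k | d (mk [s] * k) ≠ d k}.Finite :=
      (Set.toFinite {1, mk [(b, false)]}).subset fun k hk => (hd s k hk).2
    intro z
    induction z using FreeGroup.induction_on with
    | C1 => simp
    | of x => exact hs (x, true)
    | inv_of x _ => exact hs (x, false)
    | mul x y hx hy =>
      refine (hy.union (hx.preimage (mul_right_injective y).injOn)).subset fun k hk => ?_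
      by_contra hcon
      simp only [Set.mem_union, Set.mem_preimage, Set.mem_ofPred_eq, not_or, not_not] at hcon
      exact hk (by rw [mul_assoc, hcon.2, hcon.1])
  refine ⟨fun g => d (φ.symm g)⁻¹, fun z => ?_, fun h => ?_, ?_⟩
  · have := (hd' (φ.symm z)⁻¹).preimage
      (f := fun g => (φ.symm g)⁻¹) (inv_injective.comp φ.symm.injective).injOn
    simpa [Set.preimage] using this
  · by_contra hne
    refine hab (hd (a, false) (φ.symm h)⁻¹ ?_).1
    rw [show mk [(a, false)] = (of a)⁻¹ from rfl]
    simpa using hne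
  · simp [d, invRev]

/-- **Whitehead's cut vertex lemma.** The Whitehead graph of a cyclically reduced word `W` has the
letters as vertices, and for each cyclic rotation of `W` an edge from its first letter to the
inverse of its last letter. If `W` represents a conjugate of a primitive element, then for a
suitable `d`, which is a letter or `none`, the graph with the vertex `d` removed is disconnected:
it has a colouring `ε` that is constant along edges and takes both values. -/
theorem exists_cut_vertex [Finite α] (φ : MulAut (FreeGroup α)) {a b : α} (hab : a ≠ b)
    {W : List (α × Bool)} (hW : IsCyclicallyReduced W) (hconj : IsConj (mk W) (φ (of a))) :
    ∃ (d : Option (α × Bool)) (ε : α × Bool → Bool),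
      (∃ s t, some s ≠ d ∧ some t ≠ d ∧ ε s ≠ ε t) ∧
      ∀ l₁ l₂, W = l₁ ++ l₂ → ∀ s ∈ (l₂ ++ l₁).head?, ∀ t ∈ (l₂ ++ l₁).getLast?,
        some s ≠ d → some (t.1, !t.2) ≠ d → ε s = ε (t.1, !t.2) := by
  obtain ⟨c, hc, hinv, hne⟩ := exists_almostInvariant φ hab
  have hinf (g : FreeGroup α) : {h | c h = c g}.Infinite := by
    have hu : φ (of a) ≠ 1 := by simp
    refine (Set.infinite_range_of_injective ((mul_right_injective g).comp
      (IsMulTorsionFree.pow_right_injective hu))).mono ?_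
    rintro _ ⟨n, rfl⟩
    induction n with
    | zero => simp
    | succ n ih =>
      simp only [Function.comp_apply, Set.mem_ofPred_eq] at ih ⊢
      rw [pow_succ, ← mul_assoc, hinv, ih]
  have h0 : ¬ ∃ ε, AlmostConstOnCone c [] ε := by
    rintro ⟨ε, hε⟩
    simp only [AlmostConstOnCone, List.nil_prefix, true_and] at hε
    obtain ⟨g, hg⟩ : ∃ g, c g ≠ ε := by
      by_contra! hcon
      exact hne (by rw [hcon, hcon])
    exact hinf g (hε.subset fun h hh => by simpa [Set.mem_ofPred_eq ▸ hh] using hg)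
  obtain ⟨L, hL, hchild⟩ := hc.exists_maximal_cone h0
  choose ε hε using hchild
  have hLred : IsReduced L := by
    by_contra hcon
    exact hL ⟨true, almostConstOnCone_of_not_isReduced hcon _⟩
  -- The direction from `L` towards the root is the cut vertex.
  let d : Option (α × Bool) := L.getLast?.map fun t => (t.1, !t.2)
  have hd (s : α × Bool) : IsReduced (L ++ [s]) ↔ some s ≠ d := by
    rw [IsReduced, List.isChain_append]
    rcases L.eq_nil_or_concat' with rfl | ⟨L', t, rfl⟩
    · simp [d]
    · obtain ⟨s1, s2⟩ := s
      obtain ⟨t1, t2⟩ := t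
      have : List.IsChain (fun a b : α × Bool => a.1 = b.1 → a.2 = b.2) (L' ++ [(t1, t2)]) := hLred
      simp [d, this]
      cases s2 <;> cases t2 <;> simp [eq_comm]
  refine ⟨d, ε, ?_, ?_⟩
  · by_contra! hcon
    apply hL
    by_cases hex : ∃ s, some s ≠ d
    · obtain ⟨s, hs⟩ := hex
      refine ⟨ε s, almostConstOnCone_of_forall fun t => ?_⟩
      by_cases ht : some t = d
      · exact almostConstOnCone_of_not_isReduced (by simpa [hd] using ht) _
      · rw [hcon s t hs ht]
        exact hε t
    · push Not at hex
      exact ⟨true, almostConstOnCone_of_forall fun t =>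
        almostConstOnCone_of_not_isReduced (by simpa [hd] using hex t) _⟩
  · rintro l₁ l₂ rfl s hs t ht hsd htd
    -- The ray and its inverse leave `L` in the directions `s` and `t⁻¹`.
    obtain ⟨z, hz⟩ := isConj_iff.1 ((isConj_mk_append_comm l₁ l₂).symm.trans hconj)
    have hV : IsCyclicallyReduced (l₂ ++ l₁) := hW.append_comm
    generalize l₂ ++ l₁ = V at hs ht hz hV
    rw [← hc.colour_eq_of_ray (z := z) (by simpa [hz] using hinv) hV hs ((hd s).2 hsd) (hε s)]
    refine hc.colour_eq_of_ray (z := z) (W := invRev V) (fun h => ?_) hV.invRev ?_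
      ((hd _).2 htd) (hε _)
    · rw [← inv_mk, ← conj_inv, hz, ← hinv, inv_mul_cancel_right]
    · simp only [Option.mem_def] at ht
      simp [invRev, ht]

end CutVertex

/-! ### Squares of both generators in a primitive word of rank two -/

theorem exists_consecutive {β : Type*} {p : β → Prop} {s t : β} (hs : p s) (ht : ¬ p t)
    (l : List β) : ∃ l₁ l₂ s' t', s :: (l ++ [t]) = l₁ ++ s' :: t' :: l₂ ∧ p s' ∧ ¬ p t' := by
  induction l generalizing s with
  | nil => exact ⟨[], [], s, t, rfl, hs, ht⟩
  | cons a l ih =>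
    by_cases ha : p a
    · obtain ⟨l₁, l₂, s', t', h, hs', ht'⟩ := ih ha
      exact ⟨s :: l₁, l₂, s', t', by simp [← h], hs', ht'⟩
    · exact ⟨[], l ++ [t], s, a, rfl, hs, ha⟩

theorem letter_cases
    (u : Fin 2 × Bool) :
    u = (0, true) ∨ u = (0, false) ∨ u = (1, true) ∨ u = (1, false) := by
  decide +revert

/-- A graph on the four letters that contains the path `x, x⁻¹, y, y⁻¹`, an edge from `x` to `y` or
`y⁻¹`, and an edge from `y⁻¹` to `x` or `x⁻¹`, has no cut vertex. -/
theorem colour_eq_of_edges {d : Option (Fin 2 × Bool)} {ε : Fin 2 × Bool → Bool}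
    (hxx : some (0, true) ≠ d → some (0, false) ≠ d → ε (0, true) = ε (0, false))
    (hxy : some (1, true) ≠ d → some (0, false) ≠ d → ε (1, true) = ε (0, false))
    (hyy : some (1, true) ≠ d → some (1, false) ≠ d → ε (1, true) = ε (1, false))
    (hx : (some (0, true) ≠ d → some (1, true) ≠ d → ε (0, true) = ε (1, true)) ∨
      (some (0, true) ≠ d → some (1, false) ≠ d → ε (0, true) = ε (1, false)))
    (hy : (some (0, true) ≠ d → some (1, false) ≠ d → ε (0, true) = ε (1, false)) ∨
      (some (0, false) ≠ d → some (1, false) ≠ d → ε (0, false) = ε (1, false)))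
    (s t : Fin 2 × Bool) (hs : some s ≠ d) (ht : some t ≠ d) : ε s = ε t := by
  have hd : d = none ∨ d = some (0, true) ∨ d = some (0, false) ∨ d = some (1, true) ∨
      d = some (1, false) := by
    rcases d with - | u
    · exact Or.inl rfl
    · simpa only [Option.some_inj, reduceCtorEq, false_or] using letter_cases u
  rcases hd with rfl | rfl | rfl | rfl | rfl <;>
    simp only [ne_eq, Option.some_inj, Prod.mk.injEq, reduceCtorEq, Fin.isValue, zero_ne_one,
      one_ne_zero, Bool.true_eq_false, Bool.false_eq_true, and_false, and_self, and_true,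
      not_false_eq_true, not_true_eq_false, forall_const, false_imp_iff, true_or, or_true] at hxx hxy hyy hx hy hs ht <;>
    rcases letter_cases s with rfl | rfl | rfl | rfl <;>
    rcases letter_cases t with rfl | rfl | rfl | rfl <;>
    grind only

/-- The Whitehead graph of a cyclically reduced word with subword `x x y y` contains the path
`x, x⁻¹, y, y⁻¹`, and each end of the path has a neighbour other than the one on the path: in the
cyclic word, some `x` follows another letter, and some `y` precedes another letter. Hence the graph
has no cut vertex, and the word is not conjugate to a primitive element. -/
theorem not_isConj_of_infix {W : List (Fin 2 × Bool)} (hW : IsCyclicallyReduced W)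
    (hinf : [(0, true), (0, true), (1, true), (1, true)] <:+: W)
    (φ : MulAut (FreeGroup (Fin 2))) : ¬ IsConj (mk W) (φ (of 0)) := by
  rintro hconj
  obtain ⟨r₁, r₂, rfl⟩ := hinf
  -- Rotate the word so that it starts with `x x y y`.
  rw [List.append_assoc] at hW hconj
  replace hconj := (isConj_mk_append_comm _ _).symm.trans hconj
  replace hW := hW.append_comm
  rw [List.append_assoc] at hW hconj
  generalize r₂ ++ r₁ = m at hW hconj
  obtain ⟨d, ε, ⟨s₀, t₀, hs₀, ht₀, hne⟩, hedge⟩ :=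
    exists_cut_vertex φ (show (0 : Fin 2) ≠ 1 by decide) hW hconj
  have hm (s t : Fin 2 × Bool) (l₁ l₂ : List (Fin 2 × Bool))
      (h : [(0, true), (0, true), (1, true), (1, true)] ++ m ++ [(0, true)] = l₁ ++ t :: s :: l₂) :
      (t.1 = s.1 → t.2 = s.2) ∧
        (some s ≠ d → some (t.1, !t.2) ≠ d → ε s = ε (t.1, !t.2)) := by
    constructor
    · have hred := isCyclicallyReduced_iff_isReduced_append_self.1 hW
      have : IsReduced [t, s] := hred.infix <| List.IsInfix.trans
        (l₂ := [(0, true), (0, true), (1, true), (1, true)] ++ m ++ [(0, true)])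
        ⟨l₁, l₂, by rw [h]; simp⟩ ⟨[], [(0, true), (1, true), (1, true)] ++ m, by simp⟩
      exact (isReduced_cons_cons.1 this).1
    · rcases l₂.eq_nil_or_concat' with rfl | ⟨l₂', u, rfl⟩
      · have h' : [(0, true), (0, true), (1, true), (1, true)] ++ m ++ [(0, true)]
          = (l₁ ++ [t]) ++ [s] := by simpa using h
        obtain ⟨h1, h2⟩ := List.append_inj' h' rfl
        rw [List.singleton_inj] at h2
        subst h2
        refine hedge [] ([(0, true), (0, true), (1, true), (1, true)] ++ m) rfl _ (by simp) t ?_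
        rw [h1]
        simp
      · have h' : [(0, true), (0, true), (1, true), (1, true)] ++ m ++ [(0, true)]
          = ((l₁ ++ [t]) ++ s :: l₂') ++ [u] := by simpa using h
        exact hedge (l₁ ++ [t]) (s :: l₂') (List.append_inj' h' rfl).1 s (by simp) t (by
          rw [← List.append_assoc, List.getLast?_append]; simp)
  have hxx := (hm (0, true) (0, true) [] _ rfl).2
  have hxy := (hm (1, true) (0, true) [(0, true)] _ rfl).2
  have hyy := (hm (1, true) (1, true) [(0, true), (0, true)] _ rfl).2
  have hx : (some (0, true) ≠ d → some (1, true) ≠ d → ε (0, true) = ε (1, true)) ∨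
      (some (0, true) ≠ d → some (1, false) ≠ d → ε (0, true) = ε (1, false)) := by
    obtain ⟨l₁, l₂, t, s, hl, ht, hs⟩ := exists_consecutive (p := fun u => u ≠ (0, true))
      (s := (1, true)) (t := (0, true)) (by simp) (by simp) m
    rw [not_not] at hs
    subst hs
    obtain ⟨hred, hε⟩ := hm (0, true) t ([(0, true), (0, true), (1, true)] ++ l₁) l₂
      (by simp [← hl])
    rcases letter_cases t with rfl | rfl | rfl | rfl
    · exact absurd rfl ht
    · simp at hred
    · exact Or.inr hε
    · exact Or.inl hε
  have hy : (some (0, true) ≠ d → some (1, false) ≠ d → ε (0, true) = ε (1, false)) ∨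
      (some (0, false) ≠ d → some (1, false) ≠ d → ε (0, false) = ε (1, false)) := by
    obtain ⟨l₁, l₂, t, s, hl, rfl, hs⟩ := exists_consecutive (p := fun u => u = (1, true))
      (s := (1, true)) (t := (0, true)) (by simp) (by simp) m
    obtain ⟨hred, hε⟩ := hm s (1, true) ([(0, true), (0, true), (1, true)] ++ l₁) l₂
      (by simp [← hl])
    rcases letter_cases s with rfl | rfl | rfl | rfl
    · exact Or.inl hε
    · exact Or.inr hε
    · exact absurd rfl hs
    · simp at hred
  exact hne (colour_eq_of_edges hxx hxy hyy hx hy s₀ t₀ hs₀ ht₀)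

theorem toWord_of_pow_mul_of_pow {α : Type*} [DecidableEq α] (a b : α) (m n : ℕ) :
    (of a ^ m * of b ^ n).toWord =
      List.replicate m (a, true) ++ List.replicate n (b, true) := by
  rw [toWord_mul, toWord_of_pow, toWord_of_pow]
  apply IsReduced.reduce_eq
  refine List.Pairwise.isChain (List.pairwise_of_forall_mem_list ?_)
  intro s hs t ht _
  simp only [List.mem_append, List.mem_replicate] at hs ht
  rcases hs with ⟨-, rfl⟩ | ⟨-, rfl⟩ <;> rcases ht with ⟨-, rfl⟩ | ⟨-, rfl⟩ <;> rfl

theorem isPrimitivityBlocking_pow_mul_pow {k : ℕ} (hk : 2 ≤ k) :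
    IsPrimitivityBlocking (of 0 ^ k * of 1 ^ k : FreeGroup (Fin 2)) := by
  intro φ h
  refine not_isConj_of_infix (reduceCyclically.isCyclicallyReduced isReduced_toWord) ?_ φ
    (isConj_mk_reduceCyclically _)
  refine List.IsInfix.trans ?_ h
  obtain ⟨n, rfl⟩ := Nat.exists_eq_add_of_le' hk
  rw [toWord_of_pow_mul_of_pow]
  refine ⟨List.replicate n (0, true), List.replicate n (1, true), ?_⟩
  rw [List.replicate_add, Nat.add_comm n 2, List.replicate_add]
  simp [List.replicate_succ]

/-! ### Elementary automorphisms -/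

section Elementary

variable {α : Type*} [DecidableEq α]

/-- The endomorphism that sends `x_i` to `g x_i h` and fixes the other basis elements. -/
def elementaryHom (i : α) (g h : FreeGroup α) : FreeGroup α →* FreeGroup α :=
  lift (Function.update of i (g * of i * h))

theorem elementaryHom_of_self (i : α) (g h : FreeGroup α) :
    elementaryHom i g h (of i) = g * of i * h := by
  simp [elementaryHom]

theorem elementaryHom_of_ne {i j : α} (hij : j ≠ i) (g h : FreeGroup α) :
    elementaryHom i g h (of j) = of j := by
  simp [elementaryHom, hij]

theorem elementaryHom_eq_self {i : α} {u : FreeGroup α}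
    (hu : u ∈ Subgroup.closure (of '' {j | j ≠ i})) (g h : FreeGroup α) :
    elementaryHom i g h u = u := by
  have : Subgroup.closure (of '' {j | j ≠ i}) ≤
      (elementaryHom i g h).eqLocus (MonoidHom.id _) := by
    rw [Subgroup.closure_le]
    rintro _ ⟨j, hj, rfl⟩
    exact elementaryHom_of_ne hj g h
  exact this hu

theorem elementaryHom_comp_inv {i : α} {g h : FreeGroup α}
    (hg : g ∈ Subgroup.closure (of '' {j | j ≠ i}))
    (hh : h ∈ Subgroup.closure (of '' {j | j ≠ i})) :
    (elementaryHom i g h).comp (elementaryHom i g⁻¹ h⁻¹) = MonoidHom.id _ := by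
  refine ext_hom _ _ fun j => ?_
  rcases eq_or_ne j i with rfl | hj
  · simp only [MonoidHom.comp_apply, elementaryHom_of_self, _root_.map_mul,
      elementaryHom_eq_self (inv_mem hg), elementaryHom_eq_self (inv_mem hh), MonoidHom.id_apply]
    group
  · simp [elementaryHom_of_ne hj]

/-- The automorphism that sends `x_i` to `g x_i h` and fixes the other basis elements, for `g` and
`h` in the subgroup that these generate. -/
def elementaryAut (i : α) (g h : FreeGroup α)
    (hg : g ∈ Subgroup.closure (of '' {j | j ≠ i}))
    (hh : h ∈ Subgroup.closure (of '' {j | j ≠ i})) : MulAut (FreeGroup α) :=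
  MonoidHom.toMulEquiv (elementaryHom i g h) (elementaryHom i g⁻¹ h⁻¹)
    (by simpa using elementaryHom_comp_inv (inv_mem hg) (inv_mem hh))
    (elementaryHom_comp_inv hg hh)

end Elementary

/-! ### Products of powers of the generators -/

variable {r : ℕ}

theorem powersProd_mem_closure {m : ℕ} (hm : m ≤ r) (k : ℕ) {i : Fin r} (hi : m ≤ i) :
    powersProd m hm k ∈ Subgroup.closure (of '' {j | j ≠ i}) := by
  refine Subgroup.list_prod_mem _ fun u hu => ?_
  obtain ⟨j, rfl⟩ := List.mem_ofFn.1 hu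
  refine pow_mem (Subgroup.subset_closure (Set.mem_image_of_mem of ?_)) k
  rintro rfl
  exact absurd j.2 (Nat.not_lt.2 hi)

theorem powersProd_succ {m : ℕ} (hm : m + 1 ≤ r) (k : ℕ) :
    powersProd (m + 1) hm k = powersProd m (Nat.le_of_succ_le hm) k * of ⟨m, hm⟩ ^ k := by
  rw [powersProd, List.ofFn_succ', List.concat_eq_append, List.prod_append, List.prod_singleton]
  rfl

theorem witnessWord_succ (hr : 3 ≤ r + 1) (k : ℕ) :
    witnessWord (r + 1) hr k = powersProd r r.le_succ k * of (Fin.last r) ^ k *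
      (powersProd r r.le_succ k)⁻¹ * of ⟨1, by omega⟩ := by
  rw [witnessWord, powersProd_succ]
  rfl

/-- The witness is the image of `x_r ^ k x_2` under the automorphism that conjugates `x_r` by
`x_1 ^ k ⋯ x_{r-1} ^ k`. -/
theorem isPrimitive_witnessWord [NeZero r] (hr : 3 ≤ r) (k : ℕ) :
    IsPrimitive (witnessWord r hr k) := by
  obtain ⟨n, rfl⟩ : ∃ n, r = n + 1 := ⟨r - 1, by omega⟩
  let i₁ : Fin (n + 1) := ⟨1, by omega⟩
  have hne : i₁ ≠ Fin.last n := by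
    simp only [i₁, ne_eq, Fin.ext_iff, Fin.val_last]
    omega
  have hP := powersProd_mem_closure n.le_succ k (i := Fin.last n) (by simp)
  have hlast : of (Fin.last n) ^ k ∈ Subgroup.closure (of '' {j | j ≠ i₁}) :=
    pow_mem (Subgroup.subset_closure (Set.mem_image_of_mem of hne.symm)) k
  refine ⟨elementaryAut (Fin.last n) _ _ hP (inv_mem hP) *
    elementaryAut i₁ _ 1 hlast (one_mem _) *
    freeGroupCongr (Equiv.swap 0 i₁), ?_⟩
  rw [witnessWord_succ]
  simp only [MulAut.mul_apply, freeGroupCongr_apply, map.of, Equiv.swap_apply_left]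
  simp only [elementaryAut, MonoidHom.toMulEquiv_apply, elementaryHom_of_self, _root_.map_mul,
    map_pow, elementaryHom_of_ne hne, mul_one, conj_pow]
  rfl

/-- The word `x_1 ^ k x_2 ^ k ⋯ x_m ^ k`. -/
def powersWord {m : ℕ} (hm : m ≤ r) (k : ℕ) : List (Fin r × Bool) :=
  (List.ofFn fun i : Fin m => List.replicate k (Fin.castLE hm i, true)).flatten

theorem mk_flatten {α : Type*} (l : List (List (α × Bool))) :
    mk l.flatten = (l.map mk).prod := by
  induction l with
  | nil => rfl
  | cons a l ih => rw [List.flatten_cons, ← mul_mk, ih, List.map_cons, List.prod_cons]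

theorem mk_replicate {α : Type*} (a : α) (k : ℕ) : mk (List.replicate k (a, true)) = of a ^ k := by
  rw [of, pow_mk]
  simp

theorem mk_powersWord {m : ℕ} (hm : m ≤ r) (k : ℕ) : mk (powersWord hm k) = powersProd m hm k := by
  rw [powersWord, mk_flatten, List.map_ofFn, powersProd]
  simp only [Function.comp_def, mk_replicate]

theorem mem_powersWord {m : ℕ} {hm : m ≤ r} {k : ℕ} {s : Fin r × Bool}
    (hs : s ∈ powersWord hm k) : s.1 < m ∧ s.2 = true := by
  simp only [powersWord, List.mem_flatten, List.mem_ofFn] at hs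
  obtain ⟨_, ⟨i, rfl⟩, hi⟩ := hs
  rw [(List.mem_replicate.1 hi).2]
  exact ⟨i.2, rfl⟩

theorem powersWord_succ {m : ℕ} (hm : m + 1 ≤ r) (k : ℕ) :
    powersWord hm k =
      powersWord (Nat.le_of_succ_le hm) k ++ List.replicate k (⟨m, hm⟩, true) := by
  rw [powersWord, List.ofFn_succ', List.concat_eq_append, List.flatten_append,
    List.flatten_singleton]
  rfl

theorem head?_powersWord {m : ℕ} (hm : m + 1 ≤ r) {k : ℕ} (hk : 1 ≤ k) :
    (powersWord hm k).head? = some (⟨0, by omega⟩, true) := by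
  obtain ⟨n, rfl⟩ := Nat.exists_eq_add_of_le' hk
  rw [powersWord, List.ofFn_succ, List.flatten_cons, List.replicate_succ]
  rfl

theorem isReduced_of_forall_snd_eq {α : Type*} {w : List (α × Bool)} {ε : Bool}
    (hw : ∀ s ∈ w, s.2 = ε) : IsReduced w :=
  List.Pairwise.isChain <| List.pairwise_of_forall_mem_list fun s hs t ht _ => by
    rw [hw s hs, hw t ht]

theorem toWord_powersProd {m : ℕ} (hm : m ≤ r) (k : ℕ) :
    (powersProd m hm k).toWord = powersWord hm k := by
  rw [← mk_powersWord, toWord_mk]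
  exact (isReduced_of_forall_snd_eq fun s hs => (mem_powersWord hs).2).reduce_eq

theorem mem_invRev {α : Type*} {w : List (α × Bool)} {s : α × Bool} (hs : s ∈ invRev w) :
    (s.1, !s.2) ∈ w := by
  simp only [invRev, List.mem_reverse, List.mem_map] at hs
  obtain ⟨t, ht, rfl⟩ := hs
  simpa using ht

theorem getLast?_invRev {α : Type*} (w : List (α × Bool)) :
    (invRev w).getLast? = w.head?.map fun s => (s.1, !s.2) := by
  simp [invRev]

theorem isCyclicallyReduced_witness (hr : 3 ≤ r + 1) {k : ℕ} (hk : 1 ≤ k) :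
    IsCyclicallyReduced (powersWord le_rfl k ++ invRev (powersWord r.le_succ k) ++
      [(⟨1, by omega⟩, true)] : List (Fin (r + 1) × Bool)) := by
  obtain ⟨m, rfl⟩ : ∃ m, r = m + 1 := ⟨r - 1, by omega⟩
  have hinv {s : Fin (m + 1 + 1) × Bool} (hs : s ∈ invRev (powersWord (m + 1).le_succ k)) :
      s.1 < m + 1 ∧ s.2 = false := by
    simpa using mem_powersWord (mem_invRev hs)
  have hlast : (invRev (powersWord (m + 1).le_succ k)).getLast? =
      some ((⟨0, by omega⟩, false) : Fin (m + 1 + 1) × Bool) := by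
    rw [getLast?_invRev, head?_powersWord _ hk]
    rfl
  refine ⟨?_, ?_⟩
  · rw [IsReduced, List.isChain_append, List.isChain_append]
    refine ⟨⟨isReduced_of_forall_snd_eq fun s hs => (mem_powersWord hs).2,
      isReduced_of_forall_snd_eq fun s hs => (hinv hs).2, fun s hs t ht hst => ?_⟩,
      List.isChain_singleton _, fun s hs t ht hst => ?_⟩
    · -- The last letter of the first block is the last generator, which the second block lacks.
      have := (hinv (List.mem_of_mem_head? ht)).1
      rw [powersWord_succ, List.getLast?_append, List.getLast?_replicate, if_neg (by omega)] at hs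
      simp at hs
      subst hs
      simp [← hst] at this
    · rw [List.getLast?_append, hlast] at hs
      simp at hs ht
      subst hs ht
      simp at hst
  · intro s hs t ht _
    rw [List.append_assoc, List.head?_append, head?_powersWord _ hk] at ht
    simp at hs ht
    rw [← hs, ← ht]

theorem toWord_witnessWord (hr : 3 ≤ r + 1) {k : ℕ} (hk : 1 ≤ k) :
    (witnessWord (r + 1) hr k).toWord = powersWord le_rfl k ++ invRev (powersWord r.le_succ k) ++
      [(⟨1, by omega⟩, true)] := by
  rw [← (isCyclicallyReduced_witness hr hk).isReduced.reduce_eq, ← toWord_mk, ← mul_mk, ← mul_mk,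
    ← inv_mk, mk_powersWord, mk_powersWord]
  rfl

end FreeGroup

open FreeGroup in
theorem proposition4p1 :
    (∀ k : ℕ, 2 ≤ k →
      IsPrimitivityBlocking
        (FreeGroup.of 0 ^ k * FreeGroup.of 1 ^ k : FreeGroup (Fin 2))) ∧
    (∀ (r : ℕ) [NeZero r] (hr : 3 ≤ r) (k : ℕ), 1 ≤ k →
      ¬ IsPrimitivityBlocking (powersProd r (le_refl r) k) ∧
      IsPrimitive (witnessWord r hr k) ∧
      FreeGroup.IsCyclicallyReduced (witnessWord r hr k).toWord ∧
      (powersProd r (le_refl r) k).toWord <:+: (witnessWord r hr k).toWord) := by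
  refine ⟨fun k hk => isPrimitivityBlocking_pow_mul_pow hk, fun r _ hr k hk => ?_⟩
  have hprim := isPrimitive_witnessWord hr k
  obtain ⟨n, rfl⟩ : ∃ n, r = n + 1 := ⟨r - 1, by omega⟩
  have hcyc : IsCyclicallyReduced (witnessWord (n + 1) hr k).toWord := by
    rw [toWord_witnessWord hr hk]
    exact isCyclicallyReduced_witness hr hk
  have hinf : (powersProd (n + 1) le_rfl k).toWord <:+: (witnessWord (n + 1) hr k).toWord := by
    rw [toWord_witnessWord hr hk, toWord_powersProd, List.append_assoc]
    exact (List.prefix_append _ _).isInfix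
  refine ⟨fun hblock => ?_, hprim, hcyc, hinf⟩
  obtain ⟨φ, hφ⟩ := hprim
  refine hblock φ ?_
  rw [hφ, hcyc.reduceCyclically_eq]
  exact hinf
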